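/- Let $n\ge 1$ and let $S_n$ be the set of permutations $\pi=(\pi_1\,\pi_2\,\ldots\,\pi_n)$ of $\{1,\ldots,n\}$. A \emph{pinnacle} of $\pi$ is an element $\pi_i$ with $1<i<n$ and $\pi_{i-1}<\pi_i>\pi_{i+1}$; the pinnacle set of $\pi$ is the set of its pinnacles. For $1\le a\le b\le n$ and $w_1=\pi_a$, $w_2=\pi_b$, the \emph{reversal} $\rho(w_1,w_2)$ transforms $\pi$ into $(\pi_1\,\ldots\,\pi_{a-1}\,\pi_b\,\pi_{b-1}\,\ldots\,\pi_a\,\pi_{b+1}\,\ldots\,\pi_n)$; it is a \emph{balanced reversal} for $\pi$ if the resulting permutation has the same pinnacle set as $\pi$. Let $\pi\in S_n$ have pinnacle set $S$, and let $p=|S|$. (1) For every $\pi'\in S_n$ with pinnacle set $S$ there is a finite sequence $T$ of reversals, each balanced for the permutation to which it is applied, that transforms $\pi$ into $\pi'$, such that every intermediate permutation has pinnacle set $S$, and such that $T$ consists of at most $4n-2\min\{p,3\}$ reversals if $p\ge 1$, and of at most $4n-2$ reversals if $p=0$. (2) Conversely, every permutation obtained from $\pi$ by a sequence of balanced reversals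 has pinnacle set $S$. Thus the balanced reversals form a class of operations by which one obtains from $\pi$ every permutation in $S_n$ with pinnacle set $S$, and no other permutation (this answers Question 4.2 of Davis et al.). -/

import Mathlib

/-- The pinnacle set of `π = (π_0 π_1 … π_{n-1})`: the values `π j` whose position `j` has both a left
neighbour `i` and a right neighbour `k`, both carrying smaller values. Positions and values are
numbered `0, …, n-1`. -/
def pinnacleSet {n : ℕ} (π : Equiv.Perm (Fin n)) : Finset (Fin n) :=
  {x | ∃ i j k : Fin n, (i : ℕ) + 1 = j ∧ (j : ℕ) + 1 = k ∧ π i < π j ∧ π k < π j ∧ π j = x}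

/-- The map of positions that flips the interval `[a, b]`, sending `i` to `a + b - i` there, and fixes
every other position (so it is the identity if `b < a`). -/
def flipFun {n : ℕ} (a b i : Fin n) : Fin n :=
  if h : a ≤ i ∧ i ≤ b then
    ⟨(a : ℕ) + b - i, by
      have h1 := Fin.le_def.mp h.1
      have h2 := b.isLt
      omega⟩
  else i

theorem flipFun_involutive {n : ℕ} (a b : Fin n) : Function.Involutive (flipFun a b) := by
  intro i
  by_cases h : a ≤ i ∧ i ≤ b
  · have h1 := Fin.le_def.mp h.1
    have h2 := Fin.le_def.mp h.2
    apply Fin.ext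
    simp only [flipFun, h, Fin.le_def, and_self, dite_true]
    rw [dif_pos (by constructor <;> omega)]
    simp only
    omega
  · simp only [flipFun, h, dite_false]

/-- `flipFun a b` as a permutation of the positions. -/
def flipPerm {n : ℕ} (a b : Fin n) : Equiv.Perm (Fin n) :=
  (flipFun_involutive a b).toPerm (flipFun a b)

/-- `π · ρ(w₁, w₂)`: the block of `π` with endpoints the elements (values) `w₁` and `w₂` is reversed.
It is meant for `w₁` not to the right of `w₂` in `π`. -/
def applyReversal {n : ℕ} (π : Equiv.Perm (Fin n)) (w₁ w₂ : Fin n) : Equiv.Perm (Fin n) :=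
  π * flipPerm (π.symm w₁) (π.symm w₂)

/-- `ρ(w₁, w₂)` is a reversal of `π` (the position of `w₁` is at most that of `w₂`), and it is balanced:
`π` and `π · ρ(w₁, w₂)` have the same pinnacle set. -/
def IsBalancedReversal {n : ℕ} (π : Equiv.Perm (Fin n)) (w₁ w₂ : Fin n) : Prop :=
  π.symm w₁ ≤ π.symm w₂ ∧ pinnacleSet (applyReversal π w₁ w₂) = pinnacleSet π

/-- The permutation obtained from `π` by applying the reversals `ρ(w₁, w₂)`, for the pairs `(w₁, w₂)` in
the list, one after the other. -/
def applyReversals {n : ℕ} : Equiv.Perm (Fin n) → List (Fin n × Fin n) → Equiv.Perm (Fin n)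
  | π, [] => π
  | π, w :: T => applyReversals (applyReversal π w.1 w.2) T

/-- The list is a sequence of balanced reversals starting from `π`: each of them is a balanced reversal
of the permutation to which it is applied. -/
def IsBalancedSequence {n : ℕ} : Equiv.Perm (Fin n) → List (Fin n × Fin n) → Prop
  | _, [] => True
  | π, w :: T =>
      IsBalancedReversal π w.1 w.2 ∧ IsBalancedSequence (applyReversal π w.1 w.2) T

/-! ### Peaks of a list between two boundary values. -/

section Peaks

/-! A permutation is read as a list with ⊤ placed at both ends. As `⊤ < x` never holds, end entries
are never peaks, even though ⊤ is itself an entry when the list is over `Fin n`.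

Two lists with the same entries and peaks are brought to a common start, with at most two balanced
reversals on each side; the common start is then deleted and induction applies. Reversals are undone
by themselves, so the second side is run backwards. With p peaks and length n, always 2p + 1 ≤ n.
Let m be the largest non-peak.

If 2p + 1 < n, some entry is a slope, which lets m be moved to the front before a smaller entry
(`reach_descent`); deleting m keeps the peaks. If 2p + 1 = n, both m and the maximum N can be moved
to the front (`reach_alternating`); deleting them loses exactly the peak N. Either way n - 1 - p
falls by 1 at a cost of at most 4 reversals, so `reach_of_peaks_eq` needs at most 4(n - 1 - p), less
than the bound claimed. -/

theorem headD_append' {α : Type*} (A B : List α) (b : α) : (A ++ B).headD b = A.headD (B.headD b) := by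
  cases A <;> simp

theorem getLastD_reverse' {α : Type*} (L : List α) (a : α) : L.reverse.getLastD a = L.headD a := by
  cases L <;> simp

theorem headD_reverse' {α : Type*} (L : List α) (a : α) : L.reverse.headD a = L.getLastD a := by
  rw [← getLastD_reverse', List.reverse_reverse]

variable {α : Type*} [LinearOrder α]

/-- The peaks among the entries of `L`, when `L` is preceded by `a` and followed by `b`. -/
def peaks : α → List α → α → Finset α
  | _, [], _ => ∅
  | a, x :: L, b => (if a < x ∧ L.headD b < x then {x} else ∅) ∪ peaks x L b

theorem peaks_append (a : α) (A B : List α) (b : α) :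
    peaks a (A ++ B) b = peaks a A (B.headD b) ∪ peaks (A.getLastD a) B b := by
  induction A generalizing a with
  | nil => simp [peaks]
  | cons x A ih =>
    rw [List.cons_append, peaks, peaks, ih, headD_append', List.getLastD_cons, Finset.union_assoc]

theorem peaks_reverse (a : α) (L : List α) (b : α) : peaks a L.reverse b = peaks b L a := by
  induction L generalizing b with
  | nil => simp [peaks]
  | cons x L ih =>
    rw [List.reverse_cons, peaks_append, getLastD_reverse']
    simp only [peaks, List.headD_cons, List.headD_nil, ih, Finset.union_empty]
    rw [Finset.union_comm]
    simp only [and_comm]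

/-- The left boundary is compared only with the first entry, and matters only if that entry beats
its right neighbour. -/
theorem peaks_cons_congr {a a' x b : α} {L : List α}
    (h : L.headD b < x → (a < x ↔ a' < x)) : peaks a (x :: L) b = peaks a' (x :: L) b := by
  have : (a < x ∧ L.headD b < x) ↔ (a' < x ∧ L.headD b < x) := by tauto
  simp only [peaks, this]

theorem peaks_concat_congr {a b b' x : α} {A : List α}
    (h : A.getLastD a < x → (b < x ↔ b' < x)) :
    peaks a (A ++ [x]) b = peaks a (A ++ [x]) b' := by
  rw [← peaks_reverse, ← peaks_reverse b', List.reverse_append, List.reverse_singleton,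
    List.singleton_append]
  exact peaks_cons_congr (by rwa [headD_reverse'])

theorem peaks_subset (a : α) (L : List α) (b : α) {x : α} (h : x ∈ peaks a L b) : x ∈ L := by
  induction L generalizing a with
  | nil => simp [peaks] at h
  | cons y L ih =>
    rw [peaks, Finset.mem_union] at h
    rcases h with h | h
    · split_ifs at h <;> simp_all
    · exact List.mem_cons_of_mem _ (ih _ h)

theorem mem_peaks_iff {a b x : α} {A B : List α} (hd : (A ++ x :: B).Nodup) :
    x ∈ peaks a (A ++ x :: B) b ↔ A.getLastD a < x ∧ B.headD b < x := by
  have h := List.nodup_append.1 hd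
  have hA : x ∉ A := fun hx => h.2.2 x hx x (by simp) rfl
  have hB : x ∉ B := (List.nodup_cons.1 h.2.1).1
  rw [peaks_append, peaks, Finset.mem_union, Finset.mem_union]
  constructor
  · rintro (h | h | h)
    · exact absurd (peaks_subset _ _ _ h) hA
    · split_ifs at h with h' 
      · exact h'
      · simp at h
    · exact absurd (peaks_subset _ _ _ h) hB
  · intro h
    rw [if_pos h]
    simp

variable [OrderTop α]

theorem peaks_top_cons (x : α) (L : List α) : peaks ⊤ (x :: L) ⊤ = peaks x L ⊤ := by
  simp [peaks]

theorem peaks_top_cons_of_lt {m y : α} (h : y ≤ m) (L : List α) :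
    peaks ⊤ (m :: y :: L) ⊤ = peaks ⊤ (y :: L) ⊤ := by
  rw [peaks_top_cons]
  exact peaks_cons_congr fun _ => by simp [h]

/-- Once the pair is removed, the head of `Z` has ⊤ instead of `w` on its left; both are larger than
it, so its status is unchanged. -/
theorem peaks_top_cons_peak {m w : α} {Z : List α} (h : m < w) (hZ : Z.headD ⊤ < w) :
    peaks ⊤ (m :: w :: Z) ⊤ = insert w (peaks ⊤ Z ⊤) := by
  rw [peaks_top_cons, peaks, if_pos ⟨h, hZ⟩]
  cases Z with
  | nil => simp at hZ
  | cons z Z =>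
    rw [Finset.insert_eq]
    congr 1
    exact peaks_cons_congr fun _ => by simpa using le_of_lt hZ

theorem peaks_top_cons_not_peak {m w : α} {Z : List α} (h : ¬ (m < w ∧ Z.headD ⊤ < w)) :
    peaks ⊤ (m :: w :: Z) ⊤ = peaks ⊤ (w :: Z) ⊤ := by
  rw [peaks_top_cons, peaks, if_neg h, peaks_top_cons]
  simp

theorem two_mul_card_peaks_lt (L : List α) (h : L ≠ []) :
    2 * (peaks ⊤ L ⊤).card + 1 ≤ L.length := by
  induction hn : L.length using Nat.strong_induction_on generalizing L with
  | _ n ih =>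
    match L, h with
    | [v], _ => simp [peaks, ← hn]
    | v :: w :: Z, _ =>
      by_cases hw : v < w ∧ Z.headD ⊤ < w
      · rw [peaks_top_cons_peak hw.1 hw.2]
        have hZ : Z ≠ [] := by rintro rfl; simp at hw
        have := ih _ (by simp [← hn]) Z hZ rfl
        have := Finset.card_insert_le w (peaks ⊤ Z ⊤)
        simp at hn
        omega
      · rw [peaks_top_cons_not_peak hw]
        have := ih _ (by simp [← hn]) (w :: Z) (by simp) rfl
        simp at hn this
        omega

/-- A list longer than an alternating list with the same number of peaks has an entry that is neither
a peak nor a valley. -/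
theorem exists_slope (L : List α) (hd : L.Nodup) (h : 2 * (peaks ⊤ L ⊤).card + 1 < L.length) :
    ∃ A x B, L = A ++ x :: B ∧
      ((x ≤ A.getLastD ⊤ ∧ B.headD ⊤ < x) ∨ (A.getLastD ⊤ < x ∧ x ≤ B.headD ⊤)) := by
  induction hn : L.length using Nat.strong_induction_on generalizing L with
  | _ n ih =>
    match L with
    | [] => simp at h
    | [v] => simp at h
    | v :: w :: Z =>
      by_cases hw : v < w ∧ Z.headD ⊤ < w
      · have hwZ : w ∉ Z := by simp at hd; exact hd.2.1
        rw [peaks_top_cons_peak hw.1 hw.2, Finset.card_insert_of_notMem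
          (fun h' => hwZ (peaks_subset _ _ _ h'))] at h
        -- Stripping a valley and a peak removes two entries and one peak, so the slack survives.
        obtain ⟨A, x, B, rfl, hx⟩ := ih _ (by simp [← hn]) Z (by simp at hd; exact hd.2.2)
          (by simp at h; omega) rfl
        refine ⟨v :: w :: A, x, B, rfl, ?_⟩
        cases A with
        | nil =>
          have := hw.2
          simp at this hx ⊢
          exact Or.inl ⟨this.le, hx⟩
        | cons a A => simpa [List.getLastD_cons] using hx
      · rcases lt_or_ge w v with hv | hv
        · exact ⟨[], v, w :: Z, rfl, Or.inl ⟨by simp, by simpa using hv⟩⟩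
        · have hv : v < w := lt_of_le_of_ne hv (by rintro rfl; simp at hd)
          refine ⟨[v], w, Z, rfl, Or.inr ⟨by simpa using hv, ?_⟩⟩
          exact not_lt.1 fun h => hw ⟨hv, h⟩

/-- `Reach k L L'`: at most `k` reversals of consecutive entries, none of which changes the set of
peaks, lead from `L` to `L'`. -/
inductive Reach : ℕ → List α → List α → Prop
  | refl (k : ℕ) (L : List α) : Reach k L L
  | step {k : ℕ} {L' : List α} (P Q R : List α)
      (h : peaks ⊤ (P ++ Q.reverse ++ R) ⊤ = peaks ⊤ (P ++ Q ++ R) ⊤)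
      (h' : Reach k (P ++ Q.reverse ++ R) L') : Reach (k + 1) (P ++ Q ++ R) L'

/-! ### Calculus of peak-preserving reversals. -/

namespace Reach

theorem mono {j k : ℕ} {L L' : List α} (h : Reach j L L') (hjk : j ≤ k) : Reach k L L' := by
  induction h generalizing k with
  | refl => exact refl _ _
  | step P Q R h _ ih =>
    obtain ⟨k, rfl⟩ : ∃ i, k = i + 1 := ⟨k - 1, by omega⟩
    exact step P Q R h (ih (by omega))

theorem trans {j k : ℕ} {L L' L'' : List α} (h : Reach j L L') (h' : Reach k L' L'') :
    Reach (j + k) L L'' := by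
  induction h with
  | refl => exact h'.mono (by omega)
  | step P Q R h _ ih => rw [Nat.add_right_comm]; exact step P Q R h (ih h')

theorem single (P Q R : List α)
    (h : peaks ⊤ (P ++ Q.reverse ++ R) ⊤ = peaks ⊤ (P ++ Q ++ R) ⊤) :
    Reach 1 (P ++ Q ++ R) (P ++ Q.reverse ++ R) := step P Q R h (refl 0 _)

theorem symm {k : ℕ} {L L' : List α} (h : Reach k L L') : Reach k L' L := by
  induction h with
  | refl => exact refl _ _
  | step P Q R h _ ih =>
    have := single P Q.reverse R (by simpa using h.symm)
    rw [List.reverse_reverse] at this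
    exact ih.trans this

theorem perm {k : ℕ} {L L' : List α} (h : Reach k L L') : L.Perm L' := by
  induction h with
  | refl => exact .refl _
  | step P Q R h _ ih =>
    refine .trans ?_ ih
    exact ((List.reverse_perm Q).symm.append_left P).append_right R

theorem peaks_eq {k : ℕ} {L L' : List α} (h : Reach k L L') : peaks ⊤ L' ⊤ = peaks ⊤ L ⊤ := by
  induction h with
  | refl => rfl
  | step P Q R h _ ih => rw [ih, h]

/-- Lifts a sequence of moves past a fixed prefix. It suffices that rearrangements of `L` with the
same peaks still agree after `C` is put in front, since every intermediate list is one. -/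
theorem append_left {k : ℕ} {L L' : List α} (C : List α) (h : Reach k L L')
    (hC : ∀ V, L.Perm V → peaks ⊤ V ⊤ = peaks ⊤ L ⊤ →
      peaks ⊤ (C ++ V) ⊤ = peaks ⊤ (C ++ L) ⊤) : Reach k (C ++ L) (C ++ L') := by
  induction h with
  | refl => exact refl _ _
  | @step j M P Q R h _ ih =>
    have hp : (P ++ Q ++ R).Perm (P ++ Q.reverse ++ R) :=
      ((List.reverse_perm Q).symm.append_left P).append_right R
    have e := hC _ hp h
    have := ih fun V hV hVp => by rw [hC V (hp.trans hV) (hVp.trans h), e]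
    simp only [List.append_assoc] at this e ⊢
    have st := @step α _ _ j (C ++ M) (C ++ P) Q R
    simp only [List.append_assoc] at st
    exact st e this

end Reach

/-- A reversal changes neighbours only at the two ends of the block, so balance can be checked
separately on `P`, `Q` and `R` with exchanged boundary values. -/
theorem peaks_flip_eq {P Q R : List α} (hQ : Q ≠ [])
    (h₁ : peaks ⊤ P (Q.getLastD ⊤) = peaks ⊤ P (Q.headD ⊤))
    (h₂ : peaks (R.headD ⊤) Q (P.getLastD ⊤) = peaks (P.getLastD ⊤) Q (R.headD ⊤))
    (h₃ : peaks (Q.headD ⊤) R ⊤ = peaks (Q.getLastD ⊤) R ⊤) :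
    peaks ⊤ (P ++ Q.reverse ++ R) ⊤ = peaks ⊤ (P ++ Q ++ R) ⊤ := by
  have e : ∀ (L : List α), L ≠ [] → ∀ a, L.headD a = L.headD ⊤ := by
    rintro (_ | ⟨x, L⟩) h a
    · exact absurd rfl h
    · rfl
  have e' : ∀ a : α, Q.getLastD a = Q.getLastD ⊤ := fun a => by
    rw [← headD_reverse', ← headD_reverse']
    exact e _ (by simpa using hQ) a
  have e₃ : ∀ (L : List α) (a : α), (P ++ L).getLastD a = L.getLastD (P.getLastD a) := by
    intro L a
    rw [← headD_reverse', List.reverse_append, headD_append', headD_reverse', headD_reverse']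
  rw [peaks_append, peaks_append, peaks_append, peaks_append, peaks_reverse, e₃, e₃,
    getLastD_reverse', headD_reverse', e' (R.headD ⊤), e' (P.getLastD ⊤), e _ hQ (R.headD ⊤),
    e _ hQ (P.getLastD ⊤), h₁, h₂, h₃]

end Peaks

/-! ### Moving the largest non-peak to the front, and the induction. -/

section Moves

variable {α : Type*} [LinearOrder α] [OrderTop α]

/-- `m` is the largest entry of `L` that is not a peak. -/
def IsMaxNonPeak (L : List α) (m : α) : Prop :=
  m ∈ L ∧ m ∉ peaks ⊤ L ⊤ ∧ ∀ x ∈ L, x ∉ peaks ⊤ L ⊤ → x ≤ m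

theorem head_notMem_peaks {x : α} {L : List α} (hd : (x :: L).Nodup) :
    x ∉ peaks ⊤ (x :: L) ⊤ := fun h => by
  have := (mem_peaks_iff (A := []) hd).1 h
  simp at this

theorem exists_isMaxNonPeak {L : List α} (hd : L.Nodup) (h : L ≠ []) : ∃ m, IsMaxNonPeak L m := by
  obtain ⟨x, L, rfl⟩ := List.exists_cons_of_ne_nil h
  have hne : ((x :: L).toFinset \ peaks ⊤ (x :: L) ⊤).Nonempty :=
    ⟨x, by simpa using head_notMem_peaks hd⟩
  obtain ⟨m, hm, hmax⟩ := Finset.exists_max_image _ id hne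
  rw [Finset.mem_sdiff, List.mem_toFinset] at hm
  exact ⟨m, hm.1, hm.2, fun y hy hy' => hmax y (by
    rw [Finset.mem_sdiff, List.mem_toFinset]; exact ⟨hy, hy'⟩)⟩

theorem IsMaxNonPeak.congr {L L' : List α} {m : α} (h : IsMaxNonPeak L m) (hp : L.Perm L')
    (he : peaks ⊤ L' ⊤ = peaks ⊤ L ⊤) : IsMaxNonPeak L' m := by
  refine ⟨hp.mem_iff.1 h.1, he ▸ h.2.1, fun x hx hx' => h.2.2 x (hp.mem_iff.2 hx) (he ▸ hx')⟩

theorem IsMaxNonPeak.head_le {m x : α} {L : List α} (h : IsMaxNonPeak (x :: L) m)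
    (hd : (x :: L).Nodup) : x ≤ m :=
  h.2.2 x (by simp) (head_notMem_peaks hd)

/-- The first entry is a non-peak, hence at most `m`. It takes the place of `m` beside the head of
`B`, which exceeds both or is absent, so no peak appears or disappears. -/
theorem reach_flip_prefix {A B : List α} {m : α} (hd : (A ++ m :: B).Nodup)
    (hm : IsMaxNonPeak (A ++ m :: B) m) (hB : m ≤ B.headD ⊤) :
    Reach 1 (A ++ m :: B) (m :: (A.reverse ++ B)) := by
  obtain ⟨q, Q, hq, hqm⟩ : ∃ q Q, A ++ [m] = q :: Q ∧ q ≤ m := by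
    cases A with
    | nil => exact ⟨m, [], rfl, le_rfl⟩
    | cons a A => exact ⟨a, A ++ [m], rfl, hm.head_le hd⟩
  have hl : (A ++ [m]).getLastD ⊤ = m := by simp
  have := Reach.single [] (A ++ [m]) B (peaks_flip_eq (by simp) rfl ?_ ?_)
  · simpa using this
  · rw [peaks_concat_congr (b := (([] : List α).getLastD ⊤)) (b' := B.headD ⊤), hq]
    · exact peaks_cons_congr fun _ => by simpa using hqm.trans hB
    · intro _; simpa using hB
  · rw [hl, hq]
    cases B with
    | nil => rfl
    | cons r B =>
      have hr : m < r := lt_of_le_of_ne hB (by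
        rintro rfl
        have := (List.nodup_append.1 hd).2.1
        simp at this)
      exact peaks_cons_congr fun _ => by simp [hr, hqm.trans_lt hr]

theorem reach_reverse (L : List α) : Reach 1 L L.reverse := by
  have := Reach.single [] L [] (by simp [peaks_reverse])
  simpa using this

/-- Either two moves bring the largest non-peak to the front so that its neighbour is smaller, or one
move brings it to the front. -/
theorem reach_front {L : List α} {m : α} (hd : L.Nodup) (hm : IsMaxNonPeak L m) :
    (∃ y Z, Reach 2 L (m :: y :: Z) ∧ y < m) ∨ (∃ Z, Reach 1 L (m :: Z) ∧ m ≤ Z.headD ⊤) := by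
  obtain ⟨A, B, rfl⟩ := List.append_of_mem hm.1
  rcases le_or_gt m (B.headD ⊤) with hB | hB
  · have h := reach_flip_prefix hd hm hB
    rcases le_or_gt m ((A.reverse ++ B).headD ⊤) with h' | h'
    · exact Or.inr ⟨_, h, h'⟩
    · left
      generalize A.reverse ++ B = Z at *
      cases Z with
      | nil => simp at h'
      | cons y Z => exact ⟨y, Z, h.mono (by omega), h'⟩
  · left
    cases B with
    | nil => simp at hB
    | cons b B =>
      have hA : m ≤ A.getLastD ⊤ := not_lt.1 fun h => hm.2.1 ((mem_peaks_iff hd).2 ⟨h, hB⟩)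
      -- Reversing the whole list puts the larger neighbour (or the end) to the right of `m`;
      -- flipping the prefix then leaves `b` just behind `m`.
      have h1 := reach_reverse (A ++ m :: b :: B)
      have e : (A ++ m :: b :: B).reverse = (b :: B).reverse ++ m :: A.reverse := by simp
      rw [e] at h1
      have h2 := reach_flip_prefix (h1.perm.nodup_iff.1 hd) (hm.congr h1.perm h1.peaks_eq)
        (by rwa [headD_reverse'])
      rw [List.reverse_reverse] at h2
      exact ⟨b, B ++ A.reverse, h1.trans h2, hB⟩

theorem peaks_flip_after_head {m w q : α} {Q R : List α} (hw : m < w) (hRw : R.headD ⊤ < w)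
    (h₂ : peaks m ((w :: Q) ++ [q]) (R.headD ⊤) = peaks m ((w :: Q) ++ [q]) m)
    (h₃ : peaks w R ⊤ = peaks q R ⊤) :
    peaks ⊤ ([m] ++ ((w :: Q) ++ [q]).reverse ++ R) ⊤ =
      peaks ⊤ ([m] ++ ((w :: Q) ++ [q]) ++ R) ⊤ := by
  refine peaks_flip_eq (by simp) (by simp [peaks]) ?_ ?_
  · change peaks _ _ m = peaks m _ _
    rw [h₂]
    exact peaks_cons_congr fun _ => by simp only [hw, hRw]
  · have : ((w :: Q) ++ [q]).getLastD ⊤ = q := by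
      rw [← headD_reverse']; simp
    rw [this]
    exact h₃

theorem getLastD_cons_of_ne_nil {α : Type*} {A : List α} (h : A ≠ []) (a b : α) :
    A.getLastD a = A.getLastD b := by
  obtain ⟨A, x, rfl⟩ := List.eq_nil_or_concat A |>.resolve_left h
  simp

/-- A slope `x` is a non-peak, so `x < m`. On a descent the block from `w` to `x` is reversed; on an
ascent the block from `w` to the entry just before `x`. Either way an entry below `m` lands behind
`m`. -/
theorem reach_slope {m w : α} {Z : List α} (hd : (m :: w :: Z).Nodup)
    (hm : IsMaxNonPeak (m :: w :: Z) m) (hw : m < w)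
    (hlen : 2 * (peaks ⊤ (m :: w :: Z) ⊤).card + 1 < (m :: w :: Z).length) :
    ∃ y Z', Reach 1 (m :: w :: Z) (m :: y :: Z') ∧ y < m := by
  have hwp : w ∈ peaks ⊤ (m :: w :: Z) ⊤ := by
    by_contra h
    exact absurd (hm.2.2 w (by simp) h) (not_le.2 hw)
  have hZw : Z.headD ⊤ < w := ((mem_peaks_iff (A := [m]) hd).1 hwp).2
  have hdZ : Z.Nodup := hd.of_cons.of_cons
  have hwZ : w ∉ Z := (List.nodup_cons.1 hd.of_cons).1
  rw [peaks_top_cons_peak hw hZw, Finset.card_insert_of_notMem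
    (fun h' => hwZ (peaks_subset _ _ _ h'))] at hlen
  obtain ⟨A, x, B, rfl, hx⟩ := exists_slope Z hdZ (by simp at hlen ⊢; omega)
  have hmx : m ≠ x := by rintro rfl; simp at hd
  have hxm : x < m := by
    refine lt_of_le_of_ne (hm.2.2 x (by simp) fun h => ?_) hmx.symm
    have h' := (mem_peaks_iff (A := m :: w :: A) hd).1 h
    rw [List.getLastD_cons, List.getLastD_cons] at h'
    rcases hx with hx | hx
    · rcases eq_or_ne A [] with rfl | hA
      · exact absurd h'.1 (not_lt.2 hZw.le)
      · rw [getLastD_cons_of_ne_nil hA w ⊤] at h'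
        exact absurd h'.1 (not_lt.2 hx.1)
    · exact absurd h'.2 (not_lt.2 hx.2)
  rcases hx with ⟨hA, hB⟩ | ⟨hA, hB⟩
  · cases B with
    | nil => simp at hB
    | cons b B =>
      have hbx : b < x := hB
      have := Reach.single _ _ _ (peaks_flip_after_head (m := m) (w := w) (q := x) (Q := A)
        (R := b :: B) hw (hbx.trans (hxm.trans hw)) ?_ ?_)
      · refine ⟨x, A.reverse ++ w :: b :: B, ?_, hxm⟩
        simpa using this
      · refine peaks_concat_congr fun h => ?_
        rw [List.getLastD_cons] at h
        rcases eq_or_ne A [] with rfl | hA'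
        · exact absurd h (not_lt.2 hZw.le)
        · rw [getLastD_cons_of_ne_nil hA' w ⊤] at h
          exact absurd h (not_lt.2 hA)
      · refine peaks_cons_congr fun _ => ?_
        simp only [not_lt.2 hbx.le, not_lt.2 (hbx.trans (hxm.trans hw)).le]
  · rcases List.eq_nil_or_concat A with rfl | ⟨A, a, rfl⟩
    · simp at hA
    · have hax : a < x := by simpa using hA
      have := Reach.single _ _ _ (peaks_flip_after_head (m := m) (w := w) (q := a) (Q := A)
        (R := x :: B) hw (hxm.trans hw) ?_ ?_)
      · refine ⟨a, A.reverse ++ w :: x :: B, ?_, hax.trans hxm⟩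
        simpa using this
      · refine peaks_concat_congr fun _ => ?_
        simp only [List.headD_cons, not_lt.2 hax.le, not_lt.2 (hax.trans hxm).le]
      · exact peaks_cons_congr fun h => absurd h (not_lt.2 hB)

/-- Reverse the block from `w` to `N`. The right neighbour `y` of the peak `N` is a non-peak, so `y
< m < w`, and `w` can take the place of `N` beside `y`. -/
theorem reach_largest_second {m w N : α} {Z : List α} (hd : (m :: w :: Z).Nodup)
    (hm : IsMaxNonPeak (m :: w :: Z) m) (hw : m < w) (hN : N ∈ w :: Z)
    (hmax : ∀ x ∈ m :: w :: Z, x ≤ N) :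
    ∃ Z', Reach 1 (m :: w :: Z) (m :: N :: Z') := by
  have hmN : m < N := hw.trans_le (hmax w (by simp))
  have hNp : N ∈ peaks ⊤ (m :: w :: Z) ⊤ := by
    by_contra h
    exact absurd (hm.2.2 N (List.mem_cons_of_mem _ hN) h) (not_le.2 hmN)
  rcases List.mem_cons.1 hN with rfl | hN
  · exact ⟨Z, Reach.refl _ _⟩
  · obtain ⟨A, B, rfl⟩ := List.append_of_mem hN
    have hB := ((mem_peaks_iff (A := m :: w :: A) hd).1 hNp).2
    cases B with
    | nil => simp at hB
    | cons y B =>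
      have hyN : y < N := hB
      have hmy : y ≠ m := by rintro rfl; simp at hd
      have hym : y < m := by
        refine lt_of_le_of_ne (hm.2.2 y (by simp) fun h => ?_) hmy
        have e : m :: w :: (A ++ N :: y :: B) = (m :: w :: A ++ [N]) ++ y :: B := by simp
        rw [e] at h hd
        have h' := ((mem_peaks_iff hd).1 h).1
        rw [← headD_reverse'] at h'
        simp at h'
        exact absurd h' (not_lt.2 hyN.le)
      have := Reach.single _ _ _ (peaks_flip_after_head (m := m) (w := w) (q := N) (Q := A)
        (R := y :: B) hw (hym.trans hw) ?_ ?_)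
      · refine ⟨A.reverse ++ w :: y :: B, ?_⟩
        simpa using this
      · refine peaks_concat_congr fun _ => ?_
        simp only [List.headD_cons, hyN, hmN]
      · refine peaks_cons_congr fun _ => ?_
        simp only [not_lt.2 hyN.le, not_lt.2 (hym.trans hw).le]

/-- In a list with slack the largest non-peak can be moved in front of a smaller entry. -/
theorem reach_descent {L : List α} {m : α} (hd : L.Nodup) (hm : IsMaxNonPeak L m)
    (hlen : 2 * (peaks ⊤ L ⊤).card + 1 < L.length) :
    ∃ y Z, Reach 2 L (m :: y :: Z) ∧ y < m := by
  rcases reach_front hd hm with h | ⟨Z, h, hZ⟩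
  · exact h
  · have hd' := h.perm.nodup_iff.1 hd
    have hm' := hm.congr h.perm h.peaks_eq
    rw [← h.peaks_eq, h.perm.length_eq] at hlen
    cases Z with
    | nil => simp at hlen
    | cons w Z =>
      have hw : m < w := lt_of_le_of_ne hZ (by rintro rfl; simp at hd')
      obtain ⟨y, Z', h', hy⟩ := reach_slope hd' hm' hw hlen
      exact ⟨y, Z', h.trans h', hy⟩

/-- In an alternating list the largest non-peak and the largest entry can be moved to the front. -/
theorem reach_alternating {L : List α} {m N : α} (hd : L.Nodup) (hm : IsMaxNonPeak L m)
    (hN : N ∈ L) (hmax : ∀ x ∈ L, x ≤ N) (hlen : L.length = 2 * (peaks ⊤ L ⊤).card + 1)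
    (h1 : 1 < L.length) : ∃ Z, Reach 2 L (m :: N :: Z) ∧ m < N := by
  rcases reach_front hd hm with ⟨y, Z, h, hy⟩ | ⟨Z, h, hZ⟩
  · have := two_mul_card_peaks_lt (y :: Z) (by simp)
    rw [← h.peaks_eq, h.perm.length_eq, peaks_top_cons_of_lt hy.le] at hlen
    simp at hlen this
    omega
  · have hd' := h.perm.nodup_iff.1 hd
    have hm' := hm.congr h.perm h.peaks_eq
    cases Z with
    | nil => simp [h.perm.length_eq] at h1
    | cons w Z =>
      have hw : m < w := lt_of_le_of_ne hZ (by rintro rfl; simp at hd')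
      have hmN : m < N := hw.trans_le (hmax w (h.perm.mem_iff.2 (by simp)))
      have hN' : N ∈ w :: Z := by
        rcases List.mem_cons.1 (h.perm.mem_iff.1 hN) with rfl | h'
        · exact absurd hmN (lt_irrefl _)
        · exact h'
      obtain ⟨Z', h'⟩ := reach_largest_second hd' hm' hw hN'
        fun x hx => hmax x (h.perm.mem_iff.2 hx)
      exact ⟨Z', h.trans h', hmN⟩

theorem reach_of_peaks_eq {L L' : List α} (hd : L.Nodup) (hp : L.Perm L')
    (he : peaks ⊤ L ⊤ = peaks ⊤ L' ⊤) :
    Reach (4 * (L.length - 1 - (peaks ⊤ L ⊤).card)) L L' := by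
  induction hn : L.length using Nat.strong_induction_on generalizing L L' with
  | _ n ih =>
    have hd' := hp.nodup_iff.1 hd
    rcases Nat.lt_or_ge 1 L.length with h1 | h1
    · have hne : L ≠ [] := by rintro rfl; simp at h1
      have hle := two_mul_card_peaks_lt L hne
      obtain ⟨m, hm⟩ := exists_isMaxNonPeak hd hne
      have hm' := hm.congr hp he.symm
      rcases Nat.lt_or_ge (2 * (peaks ⊤ L ⊤).card + 1) L.length with hlen | hlen
      · obtain ⟨y, Z, h, hy⟩ := reach_descent hd hm hlen
        obtain ⟨y', Z', h', hy'⟩ := reach_descent hd' hm' (by rwa [← he, ← hp.length_eq])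
        have hpe := h.peaks_eq
        have hpe' := h'.peaks_eq
        rw [peaks_top_cons_of_lt hy.le] at hpe
        rw [peaks_top_cons_of_lt hy'.le] at hpe'
        have hP := (h.perm.symm.trans (hp.trans h'.perm)).cons_inv
        have hdm := h.perm.nodup_iff.1 hd
        have hl := h.perm.length_eq
        have hC : ∀ V, (y :: Z).Perm V → peaks ⊤ V ⊤ = peaks ⊤ (y :: Z) ⊤ →
            peaks ⊤ (m :: V) ⊤ = peaks ⊤ V ⊤ := by
          intro V hV hVp
          cases V with
          | nil => simp at hV
          | cons v V =>
            refine peaks_top_cons_of_lt (hm.2.2 v (h.perm.mem_iff.2 (List.mem_cons_of_mem _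
              (hV.mem_iff.2 (by simp)))) ?_) V
            rw [← hpe, ← hVp]
            exact head_notMem_peaks (hV.nodup_iff.1 hdm.of_cons)
        have hmid := (ih _ (by simp at hl ⊢; omega) hdm.of_cons hP (by rw [hpe, hpe', he])
          rfl).append_left [m] fun V hV hVp => by
            rw [List.singleton_append, List.singleton_append, hC V hV hVp, hVp,
              hC _ (.refl _) rfl]
        -- Count: 2 + 4(n - 2 - p) + 2 = 4(n - 1 - p).
        refine ((h.trans hmid).trans h'.symm).mono ?_
        rw [hpe]
        simp at hl ⊢
        omega
      · have hlen : L.length = 2 * (peaks ⊤ L ⊤).card + 1 := by omega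
        obtain ⟨N, hN, hmax⟩ : ∃ N ∈ L, ∀ x ∈ L, x ≤ N := by
          obtain ⟨N, hN, hmax⟩ := Finset.exists_max_image L.toFinset id
            ⟨m, List.mem_toFinset.2 hm.1⟩
          exact ⟨N, List.mem_toFinset.1 hN, fun x hx => hmax x (List.mem_toFinset.2 hx)⟩
        obtain ⟨Z, h, hmN⟩ := reach_alternating hd hm hN hmax hlen h1
        obtain ⟨Z', h', _⟩ := reach_alternating hd' hm' (hp.mem_iff.1 hN)
          (fun x hx => hmax x (hp.mem_iff.2 hx)) (by rwa [← he, ← hp.length_eq])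
          (by rwa [← hp.length_eq])
        have hP := (h.perm.symm.trans (hp.trans h'.perm)).cons_inv.cons_inv
        have hdm := h.perm.nodup_iff.1 hd
        have hl := h.perm.length_eq
        have hNZ : N ∉ Z := (List.nodup_cons.1 hdm.of_cons).1
        have hZne : Z ≠ [] := by
          rintro rfl
          simp at hl
          omega
        have hC : ∀ V, Z.Perm V → peaks ⊤ (m :: N :: V) ⊤ = insert N (peaks ⊤ V ⊤) := by
          intro V hV
          cases V with
          | nil => exact absurd hV.eq_nil hZne
          | cons v V =>
            have hv : v ∈ Z := hV.mem_iff.2 (by simp)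
            refine peaks_top_cons_peak hmN (lt_of_le_of_ne (hmax v (h.perm.mem_iff.2
              (by simp [hv]))) ?_)
            rintro rfl
            exact hNZ hv
        have hpe := h.peaks_eq
        have hpe' := h'.peaks_eq
        rw [hC _ (.refl _)] at hpe
        rw [hC _ hP] at hpe'
        have hNp : N ∉ peaks ⊤ Z ⊤ := fun h => hNZ (peaks_subset _ _ _ h)
        have hNp' : N ∉ peaks ⊤ Z' ⊤ := fun h => hNZ (hP.mem_iff.2 (peaks_subset _ _ _ h))
        have heZ : peaks ⊤ Z ⊤ = peaks ⊤ Z' ⊤ := by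
          rw [← Finset.erase_insert hNp, ← Finset.erase_insert hNp', hpe, hpe', he]
        have hmid := (ih _ (by simp at hl ⊢; omega) hdm.of_cons.of_cons hP heZ
          rfl).append_left [m, N] fun V hV hVp => by
            change peaks ⊤ (m :: N :: V) ⊤ = peaks ⊤ (m :: N :: Z) ⊤
            rw [hC V hV, hVp, hC _ (.refl _)]
        -- The middle part has length n - 2 and p - 1 peaks, so the count is again 2 + 4(n - 2 - p)
        -- + 2.
        refine ((h.trans hmid).trans h'.symm).mono ?_
        rw [← hpe, Finset.card_insert_of_notMem hNp] at hlen ⊢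
        simp at hl ⊢
        omega
    · have : L = L' := by
        match L, h1 with
        | [], _ => exact hp.nil_eq
        | [a], _ => exact (List.perm_singleton.1 hp.symm).symm
      rw [this]
      exact Reach.refl _ _

end Moves

/-! ### From lists back to permutations and pinnacle sets. -/

section Translation

theorem mem_peaks_top_iff {α : Type*} [LinearOrder α] [OrderTop α] {L : List α} (hd : L.Nodup)
    (x : α) : x ∈ peaks ⊤ L ⊤ ↔
      ∃ A a b B, L = A ++ a :: x :: b :: B ∧ a < x ∧ b < x := by
  constructor
  · intro h
    obtain ⟨A, B, rfl⟩ := List.append_of_mem (peaks_subset _ _ _ h)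
    obtain ⟨h1, h2⟩ := (mem_peaks_iff hd).1 h
    rcases List.eq_nil_or_concat A with rfl | ⟨A, a, rfl⟩
    · simp at h1
    cases B with
    | nil => simp at h2
    | cons b B => exact ⟨A, a, b, B, by simp, by simpa using h1, by simpa using h2⟩
  · rintro ⟨A, a, b, B, rfl, h1, h2⟩
    have e : A ++ a :: x :: b :: B = (A ++ [a]) ++ x :: b :: B := by simp
    rw [e] at hd ⊢
    exact (mem_peaks_iff hd).2 (by simpa using ⟨h1, h2⟩)

theorem peaks_ofFn {n : ℕ} [NeZero n] (π : Equiv.Perm (Fin n)) :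
    peaks ⊤ (List.ofFn π) ⊤ = pinnacleSet π := by
  ext x
  rw [mem_peaks_top_iff (List.nodup_ofFn.2 π.injective)]
  simp only [pinnacleSet, Finset.mem_filter, Finset.mem_univ, true_and]
  constructor
  · rintro ⟨A, a, b, B, h, h1, h2⟩
    have hl : n = A.length + (B.length + 3) := by
      have := congrArg List.length h
      simpa using this
    have key : ∀ (i : ℕ) (hi : i < n), some (π ⟨i, hi⟩) = (A ++ a :: x :: b :: B)[i]? := by
      intro i hi
      rw [← h]
      simp [hi]
    have k0 := key A.length (by omega)
    have k1 := key (A.length + 1) (by omega)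
    have k2 := key (A.length + 2) (by omega)
    simp at k0 k1 k2
    refine ⟨⟨A.length, by omega⟩, ⟨A.length + 1, by omega⟩, ⟨A.length + 2, by omega⟩, rfl, rfl,
      ?_, ?_, k1⟩
    · rw [k0, k1]; exact h1
    · rw [k2, k1]; exact h2
  · rintro ⟨i, j, k, hij, hjk, h1, h2, rfl⟩
    have hi : (i : ℕ) < (List.ofFn π).length := by simp
    have hj : (i : ℕ) + 1 < (List.ofFn π).length := by simp [hij]
    have hk : (i : ℕ) + 1 + 1 < (List.ofFn π).length := by simp [hij, hjk]
    refine ⟨(List.ofFn π).take i, π i, π k, (List.ofFn π).drop (i + 1 + 1 + 1), ?_, h1, h2⟩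
    conv_lhs => rw [← List.take_append_drop i (List.ofFn π), List.drop_eq_getElem_cons hi,
      List.drop_eq_getElem_cons hj, List.drop_eq_getElem_cons hk]
    have ej : (⟨i + 1, by omega⟩ : Fin n) = j := Fin.ext hij
    have ek : (⟨i + 1 + 1, by omega⟩ : Fin n) = k := Fin.ext (by simp; omega)
    simp [ej, ek]

theorem ofFn_applyReversal {n : ℕ} {π : Equiv.Perm (Fin n)} {P Q R : List (Fin n)}
    (h : List.ofFn π = P ++ Q ++ R) (i j : Fin n) (hi : (i : ℕ) = P.length)
    (hj : (j : ℕ) + 1 = P.length + Q.length) :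
    List.ofFn (applyReversal π (π i) (π j)) = P ++ Q.reverse ++ R := by
  have hl : n = P.length + (Q.length + R.length) := by
    have := congrArg List.length h
    simpa using this
  have key : ∀ x : Fin n, some (π x) = (P ++ Q ++ R)[(x : ℕ)]? := by
    intro x
    rw [← h]
    simp
  apply List.ext_getElem?
  intro t
  rcases Nat.lt_or_ge t n with ht | ht
  · have e : (List.ofFn (applyReversal π (π i) (π j)))[t]? = some (π (flipFun i j ⟨t, ht⟩)) := by
      simp [ht, applyReversal, flipPerm]
    rw [e, key, List.append_assoc, List.append_assoc]
    unfold flipFun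
    split_ifs with hc
    · simp only [Fin.le_def] at hc
      rw [List.getElem?_append_right (by simp; omega), List.getElem?_append_left (by simp; omega),
        List.getElem?_append_right (by omega), List.getElem?_append_left (by simp; omega),
        List.getElem?_reverse (by omega)]
      congr 1
      simp
      omega
    · simp only [Fin.le_def] at hc
      rcases Nat.lt_or_ge t P.length with h1 | h1
      · rw [List.getElem?_append_left h1, List.getElem?_append_left h1]
      · rw [List.getElem?_append_right h1, List.getElem?_append_right h1,
          List.getElem?_append_right (by omega), List.getElem?_append_right (by simp; omega),
          List.length_reverse]
  · rw [List.getElem?_eq_none (by simpa using ht), List.getElem?_eq_none (by simp; omega)]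

theorem Reach.exists_balancedSequence {n : ℕ} [NeZero n] {k : ℕ} {L L' : List (Fin n)}
    (h : Reach k L L') (π : Equiv.Perm (Fin n)) (hπ : List.ofFn π = L) :
    ∃ T : List (Fin n × Fin n), IsBalancedSequence π T ∧
      List.ofFn (applyReversals π T) = L' ∧ T.length ≤ k := by
  induction h generalizing π with
  | refl k L => exact ⟨[], trivial, hπ, by simp⟩
  | step P Q R h _ ih =>
    -- An empty block has no end values to name a reversal by, so this trivial step is dropped.
    rcases eq_or_ne Q [] with rfl | hQ
    · obtain ⟨T, h1, h2, h3⟩ := ih π (by simpa using hπ)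
      exact ⟨T, h1, h2, by omega⟩
    · have hQ' := List.length_pos_of_ne_nil hQ
      have hl : n = P.length + (Q.length + R.length) := by
        have := congrArg List.length hπ
        simpa using this
      let i : Fin n := ⟨P.length, by omega⟩
      let j : Fin n := ⟨P.length + Q.length - 1, by omega⟩
      have hf := ofFn_applyReversal hπ i j rfl (by simp only [j]; omega)
      obtain ⟨T, h1, h2, h3⟩ := ih _ hf
      refine ⟨(π i, π j) :: T, ⟨⟨?_, ?_⟩, h1⟩, h2, by simpa using h3⟩
      · simp only [Equiv.symm_apply_apply, Fin.le_def, i, j]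
        omega
      · rw [← peaks_ofFn, ← peaks_ofFn, hf, hπ, h]

theorem IsBalancedSequence.pinnacleSet_take {n : ℕ} {π : Equiv.Perm (Fin n)}
    {T : List (Fin n × Fin n)} (h : IsBalancedSequence π T) (k : ℕ) :
    pinnacleSet (applyReversals π (T.take k)) = pinnacleSet π := by
  induction T generalizing π k with
  | nil => simp [applyReversals]
  | cons w T ih =>
    cases k with
    | zero => simp [applyReversals]
    | succ k =>
      rw [List.take_succ_cons, applyReversals, ih h.2, h.1.2]

end Translation

theorem corollary1 (n : ℕ) (hn : 1 ≤ n) (S : Finset (Fin n)) (π : Equiv.Perm (Fin n))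
    (hπ : pinnacleSet π = S) :
    (∀ π' : Equiv.Perm (Fin n), pinnacleSet π' = S →
      ∃ T : List (Fin n × Fin n),
        IsBalancedSequence π T ∧
        applyReversals π T = π' ∧
        (∀ k ≤ T.length, pinnacleSet (applyReversals π (T.take k)) = S) ∧
        (1 ≤ S.card → (T.length : ℤ) ≤ 4 * (n : ℤ) - 2 * (min S.card 3 : ℕ)) ∧
        (S.card = 0 → (T.length : ℤ) ≤ 4 * (n : ℤ) - 2)) ∧
    (∀ T : List (Fin n × Fin n), IsBalancedSequence π T →
      pinnacleSet (applyReversals π T) = S) := by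
  have : NeZero n := ⟨by omega⟩
  refine ⟨fun π' hπ' => ?_, fun T hT => ?_⟩
  · have hd : ∀ σ : Equiv.Perm (Fin n), (List.ofFn σ).Nodup := fun σ =>
      List.nodup_ofFn.2 σ.injective
    have hp : (List.ofFn π).Perm (List.ofFn π') :=
      (List.perm_ext_iff_of_nodup (hd π) (hd π')).2 fun a => by
        simp [List.mem_ofFn, π.surjective a, π'.surjective a]
    have hr := reach_of_peaks_eq (hd π) hp (by rw [peaks_ofFn, peaks_ofFn, hπ, hπ'])
    obtain ⟨T, h1, h2, h3⟩ := hr.exists_balancedSequence π rfl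
    have hc := two_mul_card_peaks_lt (List.ofFn π) (by
      intro h; have := congrArg List.length h; simp at this; omega)
    rw [peaks_ofFn, hπ, List.length_ofFn] at h3 hc
    refine ⟨T, h1, ?_, fun k _ => ?_, fun _ => ?_, fun _ => ?_⟩
    · exact Equiv.coe_fn_injective (List.ofFn_injective h2)
    · rw [h1.pinnacleSet_take, hπ]
    -- `h3` bounds the length by 4(n - 1 - p), and `hc` ensures that the natural subtraction does
    -- not truncate.
    · omega
    · omega
  · have := hT.pinnacleSet_take T.length
    rwa [List.take_length, hπ] at this
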